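/- Write $\{0,1\}^*$ for the set of finite words over $\{0,1\}$, $\epsilon$ for the empty word and $\cdot$ for concatenation. The class of star-free languages over $\{0,1\}$ is the smallest class of subsets of $\{0,1\}^*$ that contains the finite sets and is closed under Boolean combinations (with complement $B^c=\{0,1\}^*\setminus B$) and element-wise concatenation. A subset of $\{0,1\}^*$ is quantifier-free definable in the first-order structure $(\{0,1\}^*,\epsilon,\cdot)$ if it is the set of elements satisfying some quantifier-free formula $\varphi(x)$ in the signature of monoids, with parameters from $\{0,1\}^*$ allowed. Let $A = 0^*1^* = \{0^m1^n : m,n\ge 0\} \subseteq \{0,1\}^*$. Then $A = (\emptyset^c\,10\,\emptyset^c)^c$; moreover $A$ is star-free, but $A$ is not quantifier-free definable in $(\{0,1\}^*,\epsilon,\cdot)$. -/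

import Mathlib

open scoped Computability FirstOrder

/-- The class of star-free languages over the alphabet `α`: the smallest class of languages that
contains the finite languages and is closed under Boolean combinations (generated by union and
complement in `α*`) and under element-wise concatenation. -/
inductive IsStarFree {α : Type*} : Language α → Prop
  | finite (A : Language α) (hA : Set.Finite {w : List α | w ∈ A}) : IsStarFree A
  | union {A B : Language α} (hA : IsStarFree A) (hB : IsStarFree B) : IsStarFree (A ⊔ B)
  | compl {A : Language α} (hA : IsStarFree A) : IsStarFree Aᶜ
  | concat {A B : Language α} (hA : IsStarFree A) (hB : IsStarFree B) : IsStarFree (A * B)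

/-- The function symbols of the signature of monoids: a constant for the identity and a binary
symbol for the product. -/
inductive MonoidFunc : ℕ → Type
  | one : MonoidFunc 0
  | mul : MonoidFunc 2

/-- The first-order signature of monoids (no relation symbols besides equality). -/
def monoidLang : FirstOrder.Language where
  Functions := MonoidFunc
  Relations := fun _ => Empty

/-- The set of words `α*` as the first-order structure `(α*, ε, ·)`. -/
instance wordStructure (α : Type*) : monoidLang.Structure (List α) where
  funMap := fun {_} f =>
    match f with
    | .one => fun _ => []
    | .mul => fun v => v 0 ++ v 1
  RelMap := fun {_} r => r.elim

/-- A subset `s` of an `L`-structure `M` is quantifier-free definable with parameters from `P` if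
it is the set of elements satisfying some quantifier-free formula in one free variable whose
parameters are taken from `P`. (Compare `Set.Definable₁`, where quantifiers are allowed.) -/
def QFDefinable₁ {M : Type*} (P : Set M) (L : FirstOrder.Language) [L.Structure M] (s : Set M) :
    Prop :=
  ∃ φ : L[[P]].Formula (Fin 1),
    FirstOrder.Language.BoundedFormula.IsQF φ ∧ s = {x : M | φ.Realize (fun _ => x)}

/-- The language `0*1*` over the alphabet `{0, 1}`. -/
def zerosOnes : Language (Fin 2) := ({[0]} : Language (Fin 2))∗ * ({[1]} : Language (Fin 2))∗

/-! A word lies in `zerosOnes` iff it has no factor 10, which gives the complement formula and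
star-freeness. For non-definability, a quantifier-free formula in `x` is a Boolean combination of
word equations in `x` with constants. A nontrivial equation fails at every `x = 0^k 1 z` with `k`
large, uniformly in `z` (`exists_forall_substWord_ne`), so the formula cannot separate `0^N 1` from
`0^N 1 0`. -/

theorem mem_kstar_singleton_iff {α : Type*} (a : α) (w : List α) :
    w ∈ ({[a]} : Language α)∗ ↔ ∃ n, w = List.replicate n a := by
  rw [Language.mem_kstar]
  constructor
  · rintro ⟨L, rfl, hL⟩
    refine ⟨L.length, ?_⟩
    rw [(List.eq_replicate_iff (n := L.length) (a := [a])).2 ⟨rfl, fun y hy => hL y hy⟩]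
    simp
  · rintro ⟨n, rfl⟩
    exact ⟨List.replicate n [a], by simp, fun y hy => List.eq_of_mem_replicate hy⟩

theorem mem_zerosOnes_iff (w : List (Fin 2)) :
    w ∈ zerosOnes ↔ ∃ m n, w = List.replicate m 0 ++ List.replicate n 1 := by
  simp only [zerosOnes, Language.mem_mul, mem_kstar_singleton_iff]
  constructor
  · rintro ⟨_, ⟨m, rfl⟩, _, ⟨n, rfl⟩, rfl⟩
    exact ⟨m, n, rfl⟩
  · rintro ⟨m, n, rfl⟩
    exact ⟨_, ⟨m, rfl⟩, _, ⟨n, rfl⟩, rfl⟩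

theorem mem_compl_bot_mul_singleton_mul_compl_bot_iff {α : Type*} (u w : List α) :
    w ∈ (⊥ : Language α)ᶜ * ({u} : Language α) * (⊥ : Language α)ᶜ ↔ u <:+: w := by
  have top_mem (v : List α) : v ∈ (⊥ : Language α)ᶜ := id
  simp only [Language.mem_mul]
  constructor
  · rintro ⟨_, ⟨p, -, _, rfl, rfl⟩, q, -, rfl⟩
    exact ⟨p, q, rfl⟩
  · rintro ⟨p, q, rfl⟩
    exact ⟨_, ⟨p, top_mem p, u, rfl, rfl⟩, q, top_mem q, rfl⟩

theorem mem_zerosOnes_iff_not_infix (w : List (Fin 2)) :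
    w ∈ zerosOnes ↔ ¬ [1, 0] <:+: w := by
  rw [mem_zerosOnes_iff]
  constructor
  · rintro ⟨m, n, rfl⟩ h
    -- Sortedness passes to sublists, and 10 is not sorted.
    have sorted : (List.replicate m (0 : Fin 2) ++ List.replicate n 1).Pairwise (· ≤ ·) := by
      simp [List.pairwise_append, List.pairwise_replicate]
    simpa using sorted.sublist h.sublist
  · induction w with
    | nil => exact fun _ => ⟨0, 0, rfl⟩
    | cons a w ih =>
      intro h
      obtain ⟨m, n, rfl⟩ := ih fun hw => h (hw.trans (List.suffix_cons a w).isInfix)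
      obtain rfl | rfl : a = 0 ∨ a = 1 := by omega
      · exact ⟨m + 1, n, rfl⟩
      · cases m with
        | zero => exact ⟨0, n + 1, rfl⟩
        | succ m => exact (h ⟨[], _, rfl⟩).elim

theorem zerosOnes_eq_compl :
    zerosOnes =
      ((⊥ : Language (Fin 2))ᶜ * ({[1, 0]} : Language (Fin 2)) * (⊥ : Language (Fin 2))ᶜ)ᶜ := by
  ext w
  rw [mem_zerosOnes_iff_not_infix]
  exact (mem_compl_bot_mul_singleton_mul_compl_bot_iff _ w).not.symm

theorem isStarFree_zerosOnes : IsStarFree zerosOnes := by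
  have bot : IsStarFree (⊥ : Language (Fin 2)) := .finite _ Set.finite_empty
  rw [zerosOnes_eq_compl]
  exact .compl (.concat (.concat (.compl bot) (.finite _ (Set.finite_singleton [1, 0])))
    (.compl bot))

/-- Substitute the word `x` for the variable `none` in a word with one variable. -/
def substWord {α : Type*} (x : List α) (t : List (Option α)) : List α :=
  t.flatMap fun o => o.elim x fun a => [a]

@[simp]
theorem substWord_nil {α : Type*} (x : List α) : substWord x [] = [] := rfl

@[simp]
theorem substWord_cons_none {α : Type*} (x : List α) (t : List (Option α)) :
    substWord x (none :: t) = x ++ substWord x t := rfl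

@[simp]
theorem substWord_cons_some {α : Type*} (x : List α) (a : α) (t : List (Option α)) :
    substWord x (some a :: t) = a :: substWord x t := rfl

@[simp]
theorem substWord_append {α : Type*} (x : List α) (s t : List (Option α)) :
    substWord x (s ++ t) = substWord x s ++ substWord x t := List.flatMap_append

@[simp]
theorem substWord_map_some {α : Type*} (x w : List α) : substWord x (w.map some) = w := by
  induction w with
  | nil => rfl
  | cons a w ih => simp [ih]

/-- A word starting with a long block `0 ⋯ 0 1` does not overlap itself at a short distance. -/
theorem append_ne_append_substWord (t : List (Option (Fin 2))) (w : List (Fin 2)) (hw : w ≠ [])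
    (k : ℕ) (hk : w.length + t.length ≤ k) (z r : List (Fin 2)) :
    (List.replicate k 0 ++ 1 :: z) ++ r ≠
      w ++ substWord (List.replicate k 0 ++ 1 :: z) t := by
  induction t generalizing w with
  | nil =>
    intro h
    have := congrArg List.length h
    simp at this hk
    omega
  | cons o t ih =>
    cases o with
    | some a =>
      -- Moving a constant letter into `w` preserves `w.length + t.length`.
      have := ih (w ++ [a]) (by simp) (by simp at hk ⊢; omega)
      simpa using this
    | none =>
      intro h
      have hw' : 0 < w.length := List.length_pos_iff.2 hw
      simp only [List.length_cons] at hk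
      -- Compare the letters at index `k`: since `0 < w.length ≤ k`, on the right it falls in the
      -- zero block of the copy shifted by `w`.
      have hone : ((List.replicate k 0 ++ 1 :: z) ++ r)[k]? = some 1 := by simp
      have hzero : (w ++ substWord (List.replicate k 0 ++ 1 :: z) (none :: t))[k]? = some 0 := by
        rw [substWord_cons_none, List.append_assoc, List.getElem?_append_right (by omega),
          List.getElem?_append_left (by simp; omega), List.getElem?_replicate_of_lt (by omega)]
      rw [h, hzero] at hone
      simp at hone

/-- A nontrivial word equation in one variable has no solution starting with a long block
`0 ⋯ 0 1`. -/
theorem exists_forall_substWord_ne (s t : List (Option (Fin 2))) (hst : s ≠ t) :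
    ∃ N, ∀ k ≥ N, ∀ z : List (Fin 2),
      substWord (List.replicate k 0 ++ 1 :: z) s ≠ substWord (List.replicate k 0 ++ 1 :: z) t := by
  induction s generalizing t with
  | nil =>
    -- The substituted word contains a 1, so it is never empty and no bound on `k` is needed.
    refine ⟨0, fun k _ z => ?_⟩
    match t with
    | [] => exact (hst rfl).elim
    | none :: t => simp
    | some a :: t => simp
  | cons a s ih =>
    cases t with
    | nil =>
      refine ⟨0, fun k _ z => ?_⟩
      cases a <;> simp
    | cons b t =>
      match a, b with
      | none, none =>
        obtain ⟨N, hN⟩ := ih t (by simpa using hst)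
        exact ⟨N, fun k hk z h => hN k hk z (List.append_cancel_left h)⟩
      | some a, none =>
        -- The letter `a` shifts the next copy of the block; the bound is `[a].length + s.length`.
        exact ⟨s.length + 1, fun k hk z h =>
          append_ne_append_substWord s [a] (by simp) k (by simp; omega) z _ h.symm⟩
      | none, some b =>
        exact ⟨t.length + 1, fun k hk z h =>
          append_ne_append_substWord t [b] (by simp) k (by simp; omega) z _ h⟩
      | some a, some b =>
        by_cases hab : a = b
        · subst hab
          obtain ⟨N, hN⟩ := ih t (by simpa using hst)
          exact ⟨N, fun k hk z h => hN k hk z (List.cons.inj h).2⟩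
        · exact ⟨0, fun k _ z h => hab (List.cons.inj h).1⟩

/-- Every term in one variable over the structure of words is given by a word with one variable. -/
theorem exists_realize_eq_substWord {α : Type*} (P : Set (List α))
    (t : (monoidLang[[P]]).Term (Fin 1 ⊕ Fin 0)) :
    ∃ u : List (Option α), ∀ (x : List α) (xs : Fin 0 → List α),
      t.realize (Sum.elim (fun _ => x) xs) = substWord x u := by
  induction t with
  | var i =>
    obtain i | i := i
    · exact ⟨[none], fun x xs => by simp⟩
    · exact i.elim0
  | @func n f ts ih =>
    choose u hu using ih
    obtain f | f := f
    · cases f with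
      | one => exact ⟨[], fun x xs => rfl⟩
      | mul =>
        refine ⟨u 0 ++ u 1, fun x xs => ?_⟩
        rw [substWord_append, ← hu 0 x xs, ← hu 1 x xs]
        rfl
    · cases n with
      | zero =>
        refine ⟨(f : P).1.map some, fun x xs => ?_⟩
        rw [substWord_map_some]
        rfl
      | succ n => cases n <;> exact f.elim

/-- The truth value of a quantifier-free formula is eventually constant on words starting with
a long block `0 ⋯ 0 1`. -/
theorem exists_forall_realize_iff (P : Set (List (Fin 2)))
    (φ : (monoidLang[[P]]).BoundedFormula (Fin 1) 0) (hφ : φ.IsQF)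
    (xs : Fin 0 → List (Fin 2)) :
    ∃ (b : Prop) (N : ℕ), ∀ k ≥ N, ∀ z : List (Fin 2),
      φ.Realize (fun _ => List.replicate k 0 ++ 1 :: z) xs ↔ b := by
  induction hφ with
  | falsum => exact ⟨False, 0, fun k _ z => Iff.rfl⟩
  | of_isAtomic h =>
    cases h with
    | equal t₁ t₂ =>
      obtain ⟨u₁, hu₁⟩ := exists_realize_eq_substWord P t₁
      obtain ⟨u₂, hu₂⟩ := exists_realize_eq_substWord P t₂
      by_cases h : u₁ = u₂
      · exact ⟨True, 0, fun k _ z => by simp [hu₁, hu₂, h]⟩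
      · obtain ⟨N, hN⟩ := exists_forall_substWord_ne u₁ u₂ h
        refine ⟨False, N, fun k hk z => ?_⟩
        rw [FirstOrder.Language.BoundedFormula.realize_bdEqual, hu₁, hu₂]
        exact iff_false_intro (hN k hk z)
    | rel R ts => obtain R | R := R <;> exact R.elim
  | imp _ _ ih₁ ih₂ =>
    obtain ⟨b₁, N₁, h₁⟩ := ih₁
    obtain ⟨b₂, N₂, h₂⟩ := ih₂
    refine ⟨b₁ → b₂, max N₁ N₂, fun k hk z => ?_⟩
    rw [FirstOrder.Language.BoundedFormula.realize_imp, h₁ k (le_of_max_le_left hk),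
      h₂ k (le_of_max_le_right hk)]

theorem not_qfDefinable₁_zerosOnes :
    ¬ QFDefinable₁ (Set.univ : Set (List (Fin 2))) monoidLang
        {w : List (Fin 2) | w ∈ zerosOnes} := by
  rintro ⟨φ, hφ, h⟩
  obtain ⟨b, N, hN⟩ := exists_forall_realize_iff _ φ hφ default
  -- `b` and `N` do not depend on `z`, so `z = []` and `z = [0]` must agree.
  have key (z : List (Fin 2)) : List.replicate N 0 ++ 1 :: z ∈ zerosOnes ↔ b := by
    rw [← hN N le_rfl z]
    refine (Set.ext_iff.1 h (List.replicate N 0 ++ 1 :: z)).trans (iff_of_eq ?_)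
    exact congrArg (FirstOrder.Language.BoundedFormula.Realize (M := List (Fin 2)) φ _) (Subsingleton.elim _ _)
  have hin : List.replicate N 0 ++ [1] ∈ zerosOnes := (mem_zerosOnes_iff _).2 ⟨N, 1, rfl⟩
  have hout := (key [0]).2 ((key []).1 hin)
  exact (mem_zerosOnes_iff_not_infix _).1 hout ⟨List.replicate N 0, [], by simp⟩

theorem mainTheorem6 :
    zerosOnes =
        ((⊥ : Language (Fin 2))ᶜ * ({[1, 0]} : Language (Fin 2)) * (⊥ : Language (Fin 2))ᶜ)ᶜ ∧
      IsStarFree zerosOnes ∧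
      ¬ QFDefinable₁ (Set.univ : Set (List (Fin 2))) monoidLang
          {w : List (Fin 2) | w ∈ zerosOnes} :=
  ⟨zerosOnes_eq_compl, isStarFree_zerosOnes, not_qfDefinable₁_zerosOnes⟩
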